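/- **Setting.** Let $D$ be a diagram, with numbered crossings, of an oriented link $L$; let $n_+(D), n_-(D)$ be the numbers of positive and negative crossings and $w(D)=n_+(D)-n_-(D)$ the writhe. A Kauffman state $s$ marks every crossing with $A$ (the $0$-smoothing) or $B$ (the $1$-smoothing); $a(s)$ and $b(s)$ are the numbers of $A$'s and of $B$'s, $|s|$ is the number of circles of the splitting of $D$ by $s$, and $s_A$ is the state with all markers $A$. For a graded abelian group $M$ put $(M\{l\})_m=M_{m-l}$. *Khovanov homology.* Let $V$ be the free abelian group on $v_+,v_-$ of degrees $1,-1$, with $m(v_+\otimes v_+)=v_+$, $m(v_+\otimes v_-)=m(v_-\otimes v_+)=v_-$, $m(v_-\otimes v_-)=0$, $\Delta(v_+)=v_+\otimes v_-+v_-\otimes v_+$, $\Delta(v_-)=v_-\otimes v_-$. The bracket complex is $[\![D]\!]^r=\bigoplus_{b(s)=r}V^{\otimes|s|}\{b(s)\}$ (one tensor factor per circle), with the signed sum of edge maps as differential: an edge $s\to s'$ changes one marker from $A$ to $B$, acts by $m$ on two circles that merge or by $\Delta$ on one circle that splits, and has the sign $(-1)^{\#\{\text{earlier crossings that } s \text{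 marks } B\}}$. Then $\mathcal H^{k,l}(L)$ is the homology of $[\![D]\!]$ in homological degree $k+n_-(D)$ and degree $l-n_+(D)+2n_-(D)$. *The homology $\ddot H$.* Let $W$ be the free abelian group on $w_+,w_-$ of degrees $2,-2$, with $\bar m,\bar\Delta$ obtained from $m,\Delta$ by replacing $v_+$ with $w_-$ and $v_-$ with $w_+$. For $i\in\mathbb Z/2$ let $\langle\!\langle D\rangle\!\rangle_i=\bigoplus_{b(s)+|s_A|\equiv i}W^{\otimes|s|}\{a(s)-b(s)\}$, with the signed sum of edge maps, formed with $\bar m,\bar\Delta$, as differential $\partial_i:\langle\!\langle D\rangle\!\rangle_i\to\langle\!\langle D\rangle\!\rangle_{i+1}$. Put $\mathcal H^F_{i,j}(D)=(\ker\partial_i/\operatorname{im}\partial_{i+1})_j$ and $\ddot H_{i,j}(L)=\mathcal H^F_{i+w(D),\,j+3w(D)}(D)$. Up to isomorphism neither $\mathcal H^{k,l}(L)$ nor $\ddot H_{i,j}(L)$ depends on the choice of $D$; here both are computed from the same, arbitrary diagram $D$ of $L$. **Theorem.** Let $L$ be an oriented link with $N$ components and $D$ any diagram of $L$. For each $i\in\{0,1\}$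 and each even integer $j$, $$\ddot H_{i,j}(L)\cong\bigoplus_{k\in2\mathbb Z+i}\mathcal H^{k,-j/2}(L)\quad\text{if } j\in4\mathbb Z,\qquad \ddot H_{i,j}(L)\cong\bigoplus_{k\in2\mathbb Z+i+1}\mathcal H^{k,-j/2}(L)\quad\text{if } j\notin4\mathbb Z.$$ Furthermore, for each $i\in\{0,1\}$ and each even integer $j$, $$\ddot H_{i,j}(L)\cong\bigoplus_{k\in2\mathbb Z+i+n_+(D)+|s_A|}\mathcal H^{k,-j/2}(L),$$ and - if $N$ is odd, then $n_+(D)+|s_A|$ is odd and $\ddot H_{i,j}(L)=0$ for each $i\in\{0,1\}$ and $j\in4\mathbb Z$; - if $N$ is even, then $n_+(D)+|s_A|$ is even and $\ddot H_{i,j}(L)=0$ for each $i\in\{0,1\}$ and $j\in4\mathbb Z+2$. -/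

import Mathlib

open scoped DirectSum

/-!
Oriented link diagrams, the Kauffman cube of resolutions, Khovanov homology, and the
`ZMod 2`-graded homology categorifying Kauffman's version of the Jones polynomial.

A link diagram is encoded as a planar four-valent map with crossing data (a planar diagram code),
together with a number of circles without crossings.
-/

namespace KauffmanCat

/-- The four ends (half-edges) at each of the `n` crossings.  The ends `(c, 0), (c, 1), (c, 2),
(c, 3)` are listed counterclockwise around the crossing `c`, beginning with the incoming end of the
strand that passes under.  So `(c, 0), (c, 2)` belong to the lower strand and `(c, 1), (c, 3)` to
the upper strand. -/
abbrev Dart (n : ℕ) : Type := Fin n × Fin 4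

/-- The next end, counterclockwise, at the same crossing. -/
def rot {n : ℕ} (d : Dart n) : Dart n := (d.1, d.2 + 1)

/-- The other end of the same strand at the same crossing. -/
def opp {n : ℕ} (d : Dart n) : Dart n := (d.1, d.2 + 2)

/-- Whether the orientation leaves the crossing along the end `d`.  The lower strand runs from end
`0` to end `2`; the upper strand runs from end `3` to end `1` at a positive crossing and from end
`1` to end `3` at a negative one. -/
def outgoing {n : ℕ} (positive : Fin n → Bool) (d : Dart n) : Bool :=
  match d.2 with
  | 0 => false
  | 1 => positive d.1
  | 2 => true
  | 3 => !positive d.1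

/-- The faces of the map with gluing `glue`: the orbits of "go along the edge, then turn to the
next end". -/
def Face {n : ℕ} (glue : Dart n → Dart n) : Type :=
  Quot fun d d' : Dart n => d' = rot (glue d)

/-- The connected components of the four-valent graph underlying the map. -/
def GraphComponent {n : ℕ} (glue : Dart n → Dart n) : Type :=
  Quot fun d d' : Dart n => d' = rot d ∨ d' = glue d

/-- An oriented link diagram with a numbering of its crossings. -/
structure OrientedLinkDiagram where
  /-- the number of crossings -/
  n : ℕ
  /-- the number of circles of the diagram that meet no crossing -/
  loops : ℕ
  /-- which crossings are positive -/
  positive : Fin n → Bool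
  /-- `glue d` is the other end of the edge that starts at the end `d` -/
  glue : Dart n → Dart n
  glue_glue : ∀ d, glue (glue d) = d
  /-- every edge leaves a crossing at one of its ends and enters a crossing at the other -/
  outgoing_glue : ∀ d, outgoing positive (glue d) = !outgoing positive d
  /-- The map is planar.  This is Euler's formula `V - E + F = 2 C` for `V = n` vertices,
  `E = 2 n` edges, `F` faces and `C` connected components: every component has genus `0`. -/
  planar : (n : ℤ) - 2 * n + Nat.card (Face glue) = 2 * Nat.card (GraphComponent glue)

namespace OrientedLinkDiagram

variable (D : OrientedLinkDiagram)

/-- The components of the link: follow the edges and go straight on at each crossing. -/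
def LinkComponent : Type :=
  (Quot fun d d' : Dart D.n => d' = D.glue d ∨ d' = opp d) ⊕ Fin D.loops

/-- The number `N` of components of the link. -/
noncomputable def numComponents : ℕ := Nat.card D.LinkComponent

/-- The number `n_+` of positive crossings. -/
def nPos : ℕ := (Finset.univ.filter fun c => D.positive c = true).card

/-- The number `n_-` of negative crossings. -/
def nNeg : ℕ := (Finset.univ.filter fun c => D.positive c = false).card

/-- The writhe. -/
def writhe : ℤ := (D.nPos : ℤ) - D.nNeg

end OrientedLinkDiagram

/-- The two markers of a crossing; `A` is also called the `0`-smoothing, `B` the `1`-smoothing. -/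
inductive Marker
  | A
  | B
  deriving DecidableEq

/-- The end to which the smoothing joins an end.  The `A`-smoothing joins the two regions swept
out by the upper strand when it is turned counterclockwise (at a positive crossing it is the
oriented smoothing): it joins the ends `0, 1` and the ends `2, 3`.  The `B`-smoothing joins `0, 3`
and `1, 2`. -/
def Marker.join : Marker → Fin 4 → Fin 4
  | .A => ![1, 0, 3, 2]
  | .B => ![3, 2, 1, 0]

namespace OrientedLinkDiagram

variable (D : OrientedLinkDiagram)

/-- A Kauffman state. -/
abbrev State : Type := Fin D.n → Marker

/-- The state all of whose markers are `A`. -/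
def stateA : D.State := fun _ => Marker.A

variable {D}

/-- `a(s)`, the number of crossings marked `A`. -/
def State.a (s : D.State) : ℕ := (Finset.univ.filter fun c => s c = Marker.A).card

/-- `b(s)`, the number of crossings marked `B`. -/
def State.b (s : D.State) : ℕ := (Finset.univ.filter fun c => s c = Marker.B).card

/-- The circles of the splitting of the diagram by the state `s`. -/
def State.Circle (s : D.State) : Type :=
  (Quot fun d d' : Dart D.n => d' = D.glue d ∨ d' = (d.1, (s d.1).join d.2)) ⊕ Fin D.loops

/-- The circle of the splitting that runs through the end `d`. -/
def State.circleAt (s : D.State) (d : Dart D.n) : s.Circle := Sum.inl (Quot.mk _ d)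

instance (s : D.State) : Finite s.Circle := by
  unfold State.Circle
  infer_instance

noncomputable instance (s : D.State) : Fintype s.Circle := Fintype.ofFinite _

/-- `|s|`, the number of circles of the splitting by `s`. -/
noncomputable def State.numCircles (s : D.State) : ℕ := Nat.card s.Circle

end OrientedLinkDiagram

/-- The indices of the two standard generators `v_+, v_-` of `V`, or `w_+, w_-` of `W`. -/
inductive Sgn
  | plus
  | minus
  deriving DecidableEq

instance : Finite Sgn :=
  Finite.of_injective (fun x : Sgn => decide (x = Sgn.plus)) (by
    intro x y
    cases x <;> cases y <;> simp)

/-- A free abelian group on two homogeneous generators, with a multiplication and a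
comultiplication, given by their coefficients in the basis of these generators. -/
structure TwoGen where
  /-- the degrees of the generators -/
  deg : Sgn → ℤ
  /-- `mul x y z` is the coefficient of `z` in the product of `x` and `y` -/
  mul : Sgn → Sgn → Sgn → ℤ
  /-- `comul x y z` is the coefficient of `y ⊗ z` in the coproduct of `x` -/
  comul : Sgn → Sgn → Sgn → ℤ

/-- Khovanov's `V`: the degrees of `v_+, v_-` are `1, -1`, and
`v_+ v_+ = v_+`, `v_+ v_- = v_- v_+ = v_-`, `v_- v_- = 0`,
`Δ v_+ = v_+ ⊗ v_- + v_- ⊗ v_+`, `Δ v_- = v_- ⊗ v_-`. -/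
def V : TwoGen where
  deg
    | .plus => 1
    | .minus => -1
  mul
    | .plus, .plus, .plus => 1
    | .plus, .minus, .minus => 1
    | .minus, .plus, .minus => 1
    | _, _, _ => 0
  comul
    | .plus, .plus, .minus => 1
    | .plus, .minus, .plus => 1
    | .minus, .minus, .minus => 1
    | _, _, _ => 0

/-- The group `W`: the degrees of `w_+, w_-` are `2, -2`, and
`w_- w_- = w_-`, `w_+ w_- = w_- w_+ = w_+`, `w_+ w_+ = 0`,
`Δ w_- = w_+ ⊗ w_- + w_- ⊗ w_+`, `Δ w_+ = w_+ ⊗ w_+`. -/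
def W : TwoGen where
  deg
    | .plus => 2
    | .minus => -2
  mul
    | .minus, .minus, .minus => 1
    | .plus, .minus, .plus => 1
    | .minus, .plus, .plus => 1
    | _, _, _ => 0
  comul
    | .minus, .plus, .minus => 1
    | .minus, .minus, .plus => 1
    | .plus, .plus, .plus => 1
    | _, _, _ => 0

/-- The subquotient (kernel of `d` on `C`) modulo (image of `C'` under `d`) of a module `M` with an
endomorphism `d`; for `d ∘ d = 0` and `d C' ⊆ C` it is the homology of `C' ⟶ C ⟶ d C` at `C`. -/
abbrev Subquotient {M : Type} [AddCommGroup M] (d : M →ₗ[ℤ] M) (C' C : Submodule ℤ M) : Type :=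
  ↥(LinearMap.ker d ⊓ C) ⧸ (C'.map d).submoduleOf (LinearMap.ker d ⊓ C)

namespace OrientedLinkDiagram

variable (D : OrientedLinkDiagram)

/-- A Kauffman state together with a sign for every circle of its splitting.  For a fixed state `s`
these index the standard basis of the tensor product, over the circles of the splitting by `s`, of
copies of a group with two generators. -/
structure Gen where
  /-- the underlying state -/
  state : D.State
  /-- the tensor factor in the place of each circle -/
  label : state.Circle → Sgn

instance : Finite Marker :=
  Finite.of_injective (fun x : Marker => decide (x = Marker.A)) (by
    intro x y
    cases x <;> cases y <;> simp)

instance : Finite D.Gen :=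
  Finite.of_injective (β := Σ s : D.State, (s.Circle → Sgn)) (fun x => ⟨x.state, x.label⟩) (by
    rintro ⟨s, l⟩ ⟨s', l'⟩ h
    simpa using h)

noncomputable instance : Fintype D.Gen := Fintype.ofFinite _

variable {D}

/-- The degree of a basis element in the tensor product, before any shift. -/
noncomputable def Gen.deg (F : TwoGen) (x : D.Gen) : ℤ := ∑ γ, F.deg (x.label γ)

open Classical in
/-- The coefficient of `y` in the image of `x` under the edge map that changes the marker of the
crossing `c`.  The circles away from `c` keep their labels; at `c`, two circles are merged by the
multiplication or one circle is split by the comultiplication.  In each smoothing one of the two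
arcs at `c` has the end `(c, 0)` and the other one has the end `(c, 2)`. -/
noncomputable def edgeCoeff (F : TwoGen) (c : Fin D.n) (x y : D.Gen) : ℤ :=
  let p := x.state.circleAt (c, 0)
  let q := x.state.circleAt (c, 2)
  let p' := y.state.circleAt (c, 0)
  let q' := y.state.circleAt (c, 2)
  if (∀ d : Dart D.n, x.state.circleAt d ≠ p → x.state.circleAt d ≠ q →
        y.label (y.state.circleAt d) = x.label (x.state.circleAt d)) ∧
      ∀ l : Fin D.loops, y.label (Sum.inr l) = x.label (Sum.inr l) then
    if p ≠ q ∧ p' = q' then F.mul (x.label p) (x.label q) (y.label p')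
    else if p = q ∧ p' ≠ q' then F.comul (x.label p) (y.label p') (y.label q')
    else 0
  else 0

variable (D)

/-- The free abelian group on the labelled states: the direct sum over all states `s` of the tensor
products over the circles of the splitting by `s`. -/
abbrev Cube : Type := D.Gen →₀ ℤ

open Classical in
/-- The differential of the cube: the sum over all edges `ξ : s ⟶ s'` (at the crossing `c`) of
`(-1) ^ ξ` times the edge map, where the exponent is the number of crossings before `c` which `s`
marks with `B`. -/
noncomputable def diff (F : TwoGen) : D.Cube →ₗ[ℤ] D.Cube :=
  Finsupp.linearCombination ℤ fun x : D.Gen => ∑ y : D.Gen, ∑ c : Fin D.n,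
    if x.state c = Marker.A ∧ y.state = Function.update x.state c Marker.B then
      Finsupp.single y
        ((-1) ^ (Finset.univ.filter fun c' => c' < c ∧ x.state c' = Marker.B).card *
          edgeCoeff F c x y)
    else 0

/-- The component in homological degree `r` and degree `m` of the Khovanov complex before the
global shifts: the state `s` contributes `V ^ ⊗ |s| {b(s)}` in homological degree `b(s)`. -/
noncomputable def khBracket (r m : ℤ) : Submodule ℤ D.Cube :=
  Finsupp.supported ℤ ℤ {x | (x.state.b : ℤ) = r ∧ x.deg V + x.state.b = m}

/-- The Khovanov homology group `ℋ^{k, l}` of the oriented diagram, that is the homology of the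
bracket complex with the shifts `[-n_-] {n_+ - 2 n_-}`. -/
abbrev Kh (k l : ℤ) : Type :=
  Subquotient (D.diff V)
    (D.khBracket (k - 1 + D.nNeg) (l - D.nPos + 2 * D.nNeg))
    (D.khBracket (k + D.nNeg) (l - D.nPos + 2 * D.nNeg))

/-- The component of degree `j` of `⟪D⟫_i`: the sum of the groups
`W_s = W ^ ⊗ |s| {a(s) - b(s)}` over the states `s` with `b(s) + |s_A| ≡ i` modulo `2`. -/
noncomputable def bracket (i : ZMod 2) (j : ℤ) : Submodule ℤ D.Cube :=
  Finsupp.supported ℤ ℤ {x | ((x.state.b + D.stateA.numCircles : ℕ) : ZMod 2) = i ∧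
    x.deg W + ((x.state.a : ℤ) - x.state.b) = j}

/-- The homology `ℋ^F_{i, j}` of the `2`-complex `⟪D⟫`. -/
abbrev framedHomology (i : ZMod 2) (j : ℤ) : Type :=
  Subquotient (D.diff W) (D.bracket (i + 1) j) (D.bracket i j)

/-- The homology of the `2`-complex of the oriented diagram, which is `⟪D⟫` with its two parts
exchanged `w` times and with degrees shifted by `{-3 w}`, for the writhe `w`. -/
abbrev ddotH (i : ZMod 2) (j : ℤ) : Type :=
  D.framedHomology (i + (D.writhe : ZMod 2)) (j + 3 * D.writhe)

end OrientedLinkDiagram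

end KauffmanCat

/-! Exchanging the two generators (`w_±` with `v_∓`) carries the multiplication and comultiplication
of `W` to those of `V`, so it carries one cube differential to the other. Generator degrees get
multiplied by `-2`; since `a + b = n`, the shifts by `a - b` and `3w` turn degree `j` into Khovanov
degree `-j/2`. With `k = b - n_-`, the condition `b + |s_A| ≡ i + w` becomes `k ≡ i + n_+ + |s_A|`
modulo 2. Splitting a `ZMod 2`-graded part into integral degrees gives the second isomorphism
(`nonempty_ddotH_equiv`).

The rest is the congruence `n_+ + |s_A| ≡ N` (`even_nPos_add_numCircles_add_numComponents`). Circles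
of a state, and components of the link, are orbits of two matchings of the ends. If a 2-colouring is
exchanged by both matchings, the orbits are cycles of a permutation, and signs compare the numbers
of cycles modulo 2 (`even_card_quot_add_card_quot`). Two states are compared through the
checkerboard colouring, the oriented smoothing and the link through the orientation. The
checkerboard colouring comes from Euler's formula by a dimension count over `ZMod 2`.

Finally `|s| + b(s) ≡ |s_A|` forces the chain groups to vanish unless `l ≡ N`. Hence for each `j`
either the parity of `k` is the stated one or both sides are zero.

A `Subquotient` makes sense for any endomorphism, so `d ∘ d = 0` is never needed. -/

namespace KauffmanCat

/-! ### Maps of subquotients -/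

section Subquotient

variable {M N : Type} [AddCommGroup M] [AddCommGroup N] {d : M →ₗ[ℤ] M} {d' : N →ₗ[ℤ] N}
  {C' C : Submodule ℤ M} {E' E : Submodule ℤ N}

theorem subsingleton_subquotient (h : C = ⊥) : Subsingleton (Subquotient d C' C) := by
  subst h
  have : Subsingleton ↥(LinearMap.ker d ⊓ (⊥ : Submodule ℤ M)) := by
    rw [inf_bot_eq]; infer_instance
  infer_instance

/-- The map of subquotients induced by a linear map which preserves the subgroups of cycles and of
boundaries. -/
def subquotientMap (f : M →ₗ[ℤ] N)
    (hker : LinearMap.ker d ⊓ C ≤ (LinearMap.ker d' ⊓ E).comap f)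
    (him : ∀ x ∈ LinearMap.ker d ⊓ C, x ∈ C'.map d → f x ∈ E'.map d') :
    Subquotient d C' C →ₗ[ℤ] Subquotient d' E' E :=
  Submodule.mapQ _ _ (f.restrict hker) fun x hx => him x.1 x.2 hx

/-- The class of a cycle. -/
def subquotientMk (d : M →ₗ[ℤ] M) (C' C : Submodule ℤ M) (x : M)
    (hx : x ∈ LinearMap.ker d ⊓ C) : Subquotient d C' C :=
  Submodule.Quotient.mk ⟨x, hx⟩

theorem exists_subquotientMk (q : Subquotient d C' C) :
    ∃ x hx, q = subquotientMk d C' C x hx := by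
  obtain ⟨⟨x, hx⟩, rfl⟩ := Submodule.Quotient.mk_surjective _ q
  exact ⟨x, hx, rfl⟩

theorem subquotientMk_eq_zero {x : M} {hx : x ∈ LinearMap.ker d ⊓ C} :
    subquotientMk d C' C x hx = 0 ↔ x ∈ C'.map d :=
  Submodule.Quotient.mk_eq_zero _

theorem subquotientMk_sum {ι : Type*} (s : Finset ι) (x : ι → M)
    (hx : ∀ i, x i ∈ LinearMap.ker d ⊓ C) :
    subquotientMk d C' C (∑ i ∈ s, x i) (Submodule.sum_mem _ fun i _ => hx i) =
      ∑ i ∈ s, subquotientMk d C' C (x i) (hx i) := by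
  have : (⟨∑ i ∈ s, x i, Submodule.sum_mem _ fun i _ => hx i⟩ : ↥(LinearMap.ker d ⊓ C)) =
      ∑ i ∈ s, ⟨x i, hx i⟩ := by
    ext; simp
  rw [subquotientMk, this]
  exact map_sum (Submodule.mkQ _) _ _

/-- An isomorphism which commutes with the endomorphisms induces one of subquotients. -/
theorem nonempty_subquotient_equiv (e : M ≃ₗ[ℤ] N) (he : ∀ x, d' (e x) = e (d x))
    (hC : ∀ x, x ∈ C ↔ e x ∈ E) (hC' : ∀ x, x ∈ C' ↔ e x ∈ E') :
    Nonempty (Subquotient d C' C ≃+ Subquotient d' E' E) := by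
  have hcyc : ∀ x, x ∈ LinearMap.ker d ⊓ C ↔ e x ∈ LinearMap.ker d' ⊓ E := by
    intro x
    rw [Submodule.mem_inf, Submodule.mem_inf, LinearMap.mem_ker, LinearMap.mem_ker, he,
      e.map_eq_zero_iff, hC]
  have hbd : ∀ x, x ∈ C'.map d ↔ e x ∈ E'.map d' := by
    intro x
    rw [Submodule.mem_map, Submodule.mem_map]
    constructor
    · rintro ⟨y, hy, rfl⟩
      exact ⟨e y, (hC' y).1 hy, he y⟩
    · rintro ⟨y, hy, h⟩
      refine ⟨e.symm y, (hC' _).2 (by rwa [e.apply_symm_apply]), e.injective ?_⟩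
      rw [← he, e.apply_symm_apply, h]
  let F : Subquotient d C' C →ₗ[ℤ] Subquotient d' E' E :=
    subquotientMap e.toLinearMap (fun x hx => (hcyc x).1 hx) fun x _ hx => (hbd x).1 hx
  refine ⟨AddEquiv.ofBijective F.toAddMonoidHom ⟨?_, ?_⟩⟩
  · rw [injective_iff_map_eq_zero]
    intro q hq
    obtain ⟨x, hx, rfl⟩ := exists_subquotientMk q
    exact subquotientMk_eq_zero.2 ((hbd x).2 (subquotientMk_eq_zero.1 hq))
  · intro q
    obtain ⟨y, hy, rfl⟩ := exists_subquotientMk q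
    refine ⟨subquotientMk d C' C (e.symm y) ((hcyc _).2 (by rwa [e.apply_symm_apply])), ?_⟩
    change subquotientMk _ _ _ _ _ = _
    congr 1
    exact e.apply_symm_apply y

end Subquotient

/-! ### Splitting homology along an integral degree -/

section Graded

variable {X : Type} {b : X → ℤ} {T : Set X} {d : (X →₀ ℤ) →ₗ[ℤ] (X →₀ ℤ)}

/-- The homogeneous part of degree `r`. -/
noncomputable def part (b : X → ℤ) (r : ℤ) : (X →₀ ℤ) →ₗ[ℤ] (X →₀ ℤ) :=
  (Finsupp.filterAddHom fun x => b x = r).toIntLinearMap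

theorem part_apply (r : ℤ) (z : X →₀ ℤ) (x : X) :
    part b r z x = if b x = r then z x else 0 := Finsupp.filter_apply _ _ _

theorem part_single (r : ℤ) (x : X) (a : ℤ) :
    part b r (Finsupp.single x a) = if b x = r then Finsupp.single x a else 0 := by
  split_ifs with h
  · exact Finsupp.filter_single_of_pos _ h
  · exact Finsupp.filter_single_of_neg _ h

/-- This is what makes each homogeneous part of a cycle a cycle and of a boundary a boundary. -/
theorem diff_part (hd : ∀ x y, d (Finsupp.single x 1) y ≠ 0 → b y = b x + 1) (r : ℤ)
    (z : X →₀ ℤ) : part b (r + 1) (d z) = d (part b r z) := by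
  have : (part b (r + 1)) ∘ₗ d = d ∘ₗ part b r := by
    refine Finsupp.lhom_ext' fun x => LinearMap.ext_ring ?_
    simp only [LinearMap.comp_apply, Finsupp.lsingle_apply, part_single]
    ext y
    rw [part_apply]
    by_cases hy : d (Finsupp.single x 1) y = 0
    · rw [hy, ite_self]
      split_ifs
      · exact hy.symm
      · simp
    · have := hd x y hy
      by_cases hx : b x = r
      · rw [if_pos (by omega), if_pos hx]
      · rw [if_neg (by omega), if_neg hx]; simp
  exact LinearMap.congr_fun this z

theorem part_mem {P : ℤ → Prop} {z : X →₀ ℤ}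
    (hz : z ∈ Finsupp.supported ℤ ℤ {x | P (b x) ∧ x ∈ T}) (r : ℤ) :
    part b r z ∈ Finsupp.supported ℤ ℤ {x | b x = r ∧ x ∈ T} := by
  rw [Finsupp.mem_supported'] at hz ⊢
  intro x hx
  rw [part_apply]
  split_ifs with h
  · exact hz x fun hx' => hx ⟨h, hx'.2⟩
  · rfl

theorem part_eq_self {r : ℤ} {z : X →₀ ℤ}
    (hz : z ∈ Finsupp.supported ℤ ℤ {x | b x = r ∧ x ∈ T}) : part b r z = z := by
  rw [Finsupp.mem_supported'] at hz
  ext x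
  rw [part_apply]
  split_ifs with h
  · rfl
  · exact (hz x fun hx => h hx.1).symm

theorem part_eq_zero {r r' : ℤ} (hr : r ≠ r') {z : X →₀ ℤ}
    (hz : z ∈ Finsupp.supported ℤ ℤ {x | b x = r ∧ x ∈ T}) : part b r' z = 0 := by
  rw [Finsupp.mem_supported'] at hz
  ext x
  rw [part_apply]
  split_ifs with h
  · exact hz x fun hx => hr (hx.1.symm.trans h)
  · rfl

/-- For an endomorphism of degree one, the homology of a sum of homogeneous parts is the direct sum
of the homology groups of these parts. -/
theorem nonempty_subquotient_equiv_directSum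
    (hd : ∀ x y, d (Finsupp.single x 1) y ≠ 0 → b y = b x + 1) (P' P : ℤ → Prop)
    (hP : ∀ r, P' (r - 1) ↔ P r) (C' C : {r // P r} → Submodule ℤ (X →₀ ℤ))
    (hC' : ∀ r, C' r = Finsupp.supported ℤ ℤ {x | b x = r - 1 ∧ x ∈ T})
    (hC : ∀ r, C r = Finsupp.supported ℤ ℤ {x | b x = r ∧ x ∈ T}) :
    Nonempty (Subquotient d (Finsupp.supported ℤ ℤ {x | P' (b x) ∧ x ∈ T})
      (Finsupp.supported ℤ ℤ {x | P (b x) ∧ x ∈ T}) ≃+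
        ⨁ r : {r // P r}, Subquotient d (C' r) (C r)) := by
  classical
  obtain rfl : C' = _ := funext hC'
  obtain rfl : C = _ := funext hC
  set U' := Finsupp.supported ℤ ℤ {x : X | P' (b x) ∧ x ∈ T}
  set U := Finsupp.supported ℤ ℤ {x : X | P (b x) ∧ x ∈ T}
  let G' : ℤ → Submodule ℤ (X →₀ ℤ) := fun r => Finsupp.supported ℤ ℤ {x | b x = r - 1 ∧ x ∈ T}
  let G : ℤ → Submodule ℤ (X →₀ ℤ) := fun r => Finsupp.supported ℤ ℤ {x | b x = r ∧ x ∈ T}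
  have hGU : ∀ r : {r // P r}, G r ≤ U := fun r =>
    Finsupp.supported_mono fun x hx => ⟨by rw [hx.1]; exact r.2, hx.2⟩
  have hGU' : ∀ r : {r // P r}, G' r ≤ U' := fun r =>
    Finsupp.supported_mono fun x hx => ⟨by rw [hx.1]; exact (hP r).2 r.2, hx.2⟩
  have hpart : ∀ r z, z ∈ LinearMap.ker d ⊓ U → part b r z ∈ LinearMap.ker d ⊓ G r := by
    intro r z hz
    refine ⟨LinearMap.mem_ker.2 ?_, part_mem hz.2 r⟩
    rw [← diff_part hd, LinearMap.mem_ker.1 hz.1, map_zero]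
  have hbd : ∀ r z, z ∈ U'.map d → part b r z ∈ (G' r).map d := by
    rintro r _ ⟨y, hy, rfl⟩
    refine ⟨part b (r - 1) y, part_mem hy _, ?_⟩
    rw [← diff_part hd, sub_add_cancel]
  let incl : ∀ r : {r // P r}, Subquotient d (G' r) (G r) →ₗ[ℤ] Subquotient d U' U := fun r =>
    subquotientMap LinearMap.id (inf_le_inf_left _ (hGU r))
      fun x _ hx => Submodule.map_mono (hGU' r) hx
  let proj : ∀ r : {r // P r}, Subquotient d U' U →ₗ[ℤ] Subquotient d (G' r) (G r) := fun r =>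
    subquotientMap (part b r) (hpart r) fun x _ hx => hbd r x hx
  -- Projecting after including is the identity for equal degrees and zero otherwise; this yields
  -- injectivity of `Φ`.
  have hpi : ∀ r r' q, proj r' (incl r q) =
      DirectSum.of (fun r : {r // P r} => Subquotient d (G' r) (G r)) r q r' := by
    intro r r' q
    obtain ⟨x, hx, rfl⟩ := exists_subquotientMk q
    have hpx : part b r' x ∈ LinearMap.ker d ⊓ G r' := hpart _ _ ⟨hx.1, hGU r hx.2⟩
    change subquotientMk d (G' r') (G r') (part b r' x) hpx = _
    by_cases h : r = r'
    · subst h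
      rw [DirectSum.of_eq_same]
      congr 1
      exact part_eq_self hx.2
    · rw [DirectSum.of_eq_of_ne _ _ _ (Ne.symm h), subquotientMk_eq_zero,
        part_eq_zero (fun h' => h (Subtype.ext h')) hx.2]
      exact Submodule.zero_mem _
  let Φ : (⨁ r : {r // P r}, Subquotient d (G' r) (G r)) →+ Subquotient d U' U :=
    DirectSum.toAddMonoid fun r => (incl r).toAddMonoidHom
  have hproj : ∀ r u, proj r (Φ u) = u r := by
    intro r u
    induction u using DirectSum.induction_on with
    | zero => simp
    | of r' q => rw [DirectSum.toAddMonoid_of]; exact hpi _ _ _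
    | add u v hu hv => rw [map_add, map_add, hu, hv, DirectSum.add_apply]
  refine ⟨(AddEquiv.ofBijective Φ ⟨?_, ?_⟩).symm⟩
  · intro u v huv
    refine DFinsupp.ext fun r => ?_
    rw [← hproj r u, ← hproj r v, huv]
  · intro q
    obtain ⟨z, hz, rfl⟩ := exists_subquotientMk q
    -- The finitely many degrees occurring in `z`; all satisfy `P`, and `z` is the sum of its parts
    -- in these degrees.
    let R : Finset ℤ := z.support.image b
    have hR : ∀ r ∈ R, P r := by
      intro r hr
      obtain ⟨x, hx, rfl⟩ := Finset.mem_image.1 hr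
      exact ((Finsupp.mem_supported ℤ z).1 hz.2 hx).1
    have hsum : z = ∑ r : R, part b r z := by
      ext x
      rw [Finsupp.finsetSum_apply, Finset.sum_coe_sort R fun r => part b r z x]
      simp only [part_apply]
      rw [Finset.sum_ite_eq]
      split_ifs with hx
      · rfl
      · by_contra hne
        exact hx (Finset.mem_image_of_mem b (Finsupp.mem_support_iff.2 hne))
    refine ⟨∑ r : R, DirectSum.of (fun r : {r // P r} => Subquotient d (G' r) (G r))
      ⟨r, hR r r.2⟩ (subquotientMk _ _ _ (part b r z) (hpart r z hz)), ?_⟩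
    have hU : ∀ r : R, part b r z ∈ LinearMap.ker d ⊓ U := fun r =>
      inf_le_inf_left _ (hGU ⟨r, hR r r.2⟩) (hpart r z hz)
    rw [map_sum]
    trans subquotientMk d U' U (∑ r : R, part b r z) (Submodule.sum_mem _ fun i _ => hU i)
    · rw [subquotientMk_sum]
      refine Finset.sum_congr rfl fun r _ => ?_
      rw [DirectSum.toAddMonoid_of]
      rfl
    · congr 1
      exact hsum.symm

end Graded

/-! ### Orbits and sign of a permutation -/

open Equiv.Perm in
theorem card_quotient_sameCycle {α : Type*} [Fintype α] [DecidableEq α] (σ : Equiv.Perm α) :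
    Nat.card (Quotient (SameCycle.setoid σ)) + σ.cycleType.sum =
      Multiset.card σ.cycleType + Fintype.card α := by
  -- The orbits are the fibres of `F`: a moved point goes to its nontrivial cycle, a fixed point to
  -- itself.
  let F : α → σ.cycleFactorsFinset ⊕ Function.fixedPoints σ := fun x =>
    if h : σ x = x then Sum.inr ⟨x, h⟩
    else Sum.inl ⟨cycleOf σ x, cycleOf_mem_cycleFactorsFinset_iff.2 (mem_support.2 h)⟩
  have hF : ∀ x y, SameCycle σ x y ↔ F x = F y := by
    intro x y
    by_cases hx : σ x = x
    · by_cases hy : σ y = y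
      · have hFx : F x = Sum.inr ⟨x, hx⟩ := dif_pos hx
        have hFy : F y = Sum.inr ⟨y, hy⟩ := dif_pos hy
        rw [hFx, hFy, Sum.inr.injEq, Subtype.ext_iff]
        exact ⟨fun h => h.eq_of_left hx, fun h => by
          have h : x = y := h
          rw [h]⟩
      · simp only [F, hx, hy, dif_pos, dif_neg, not_false_eq_true, reduceCtorEq, iff_false]
        exact fun h => hy ((SameCycle.eq_of_left h hx) ▸ hx)
    · by_cases hy : σ y = y
      · simp only [F, hx, hy, dif_pos, dif_neg, not_false_eq_true, reduceCtorEq, iff_false]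
        exact fun h => hx ((SameCycle.eq_of_right h hy) ▸ hy)
      · simp only [F, hx, hy, dif_neg, not_false_eq_true, Sum.inl.injEq, Subtype.mk.injEq]
        exact sameCycle_iff_cycleOf_eq_of_mem_support (mem_support.2 hx) (mem_support.2 hy)
  let G : Quotient (SameCycle.setoid σ) → σ.cycleFactorsFinset ⊕ Function.fixedPoints σ :=
    Quotient.lift F fun x y h => (hF x y).1 h
  have hG : Function.Bijective G := by
    constructor
    · rintro ⟨x⟩ ⟨y⟩ h
      exact Quotient.sound ((hF x y).2 h)
    · rintro (⟨c, hc⟩ | ⟨x, hx⟩)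
      · obtain ⟨x, hx⟩ := (mem_cycleFactorsFinset_iff.1 hc).1.nonempty_support
        have hx' : σ x ≠ x := by
          rw [← (mem_cycleFactorsFinset_iff.1 hc).2 x hx]
          exact mem_support.1 hx
        refine ⟨Quotient.mk _ x, ?_⟩
        have : F x = Sum.inl ⟨c, hc⟩ := by
          simp only [F, hx', dif_neg, not_false_eq_true, Sum.inl.injEq, Subtype.mk.injEq]
          exact (cycle_is_cycleOf hx hc).symm
        exact this
      · refine ⟨Quotient.mk _ x, ?_⟩
        have : F x = Sum.inr ⟨x, hx⟩ := by
          have : σ x = x := hx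
          simp [F, this]
        exact this
  rw [Nat.card_eq_of_bijective G hG, Nat.card_sum, Nat.card_eq_fintype_card,
    Nat.card_eq_fintype_card, card_fixedPoints, Fintype.card_coe, cycleType_def,
    Multiset.card_map, Finset.card_val, ← cycleType_def]
  -- The number of fixed points is a truncated difference, hence this bound.
  have := σ.sum_cycleType_le
  omega

/-- A cycle of length `ℓ` has sign `(-1) ^ (ℓ - 1)`, fixed points included, so the exponent is the
number of points minus the number of orbits. -/
theorem sign_eq_neg_one_pow_card_quotient {α : Type*} [Fintype α] [DecidableEq α]
    (σ : Equiv.Perm α) : Equiv.Perm.sign σ =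
      (-1) ^ (Nat.card (Quotient (Equiv.Perm.SameCycle.setoid σ)) + Fintype.card α) := by
  have h := card_quotient_sameCycle σ
  have h1 := σ.sum_cycleType_le
  rw [Equiv.Perm.sign_of_cycleType]
  apply neg_one_pow_congr
  simp only [Nat.even_iff]
  omega

/-! ### Circles formed by two matchings -/

section Matching

variable {α : Type*} (k : α → Bool) (g j : α → α)

/-- The permutation of the points of colour `true` that follows the matching `g` and then the
matching `j`, both of which exchange the two colours. -/
def matchingPerm (hg : ∀ d, g (g d) = d) (hj : ∀ d, j (j d) = d)
    (kg : ∀ d, k (g d) = !k d) (kj : ∀ d, k (j d) = !k d) :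
    Equiv.Perm {d // k d = true} where
  toFun e := ⟨j (g e), by rw [kj, kg, Bool.not_not]; exact e.2⟩
  invFun e := ⟨g (j e), by rw [kg, kj, Bool.not_not]; exact e.2⟩
  left_inv e := by simp [hj, hg]
  right_inv e := by simp [hj, hg]

variable {k g j}

/-- Along a circle the colours alternate. The composite `j ∘ g` splits each circle into its two
colour classes, each a single cycle; keeping only colour `true` leaves one cycle per circle. -/
theorem card_quot_matching (hg : ∀ d, g (g d) = d) (hj : ∀ d, j (j d) = d)
    (kg : ∀ d, k (g d) = !k d) (kj : ∀ d, k (j d) = !k d) :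
    Nat.card (Quot fun d d' : α => d' = g d ∨ d' = j d) =
      Nat.card (Quotient (Equiv.Perm.SameCycle.setoid (matchingPerm k g j hg hj kg kj))) := by
  set σ := matchingPerm k g j hg hj kg kj
  have hstep : ∀ e, (Quotient.mk (Equiv.Perm.SameCycle.setoid σ) (σ e)) =
      Quotient.mk (Equiv.Perm.SameCycle.setoid σ) e := fun e =>
    Quotient.sound (Equiv.Perm.sameCycle_apply_left.2 (Equiv.Perm.SameCycle.refl _ _))
  let R : α → α → Prop := fun d d' => d' = g d ∨ d' = j d
  -- A point of colour `false` is represented by its partner under `j`.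
  let F : α → Quotient (Equiv.Perm.SameCycle.setoid σ) := fun d =>
    if h : k d = true then Quotient.mk _ ⟨d, h⟩
    else Quotient.mk _ ⟨j d, by rw [kj]; simpa using h⟩
  have hFt : ∀ d (h : k d = true), F d = Quotient.mk _ ⟨d, h⟩ := fun d h => dif_pos h
  have hFf : ∀ d (h : k (j d) = true), F d = Quotient.mk _ ⟨j d, h⟩ := fun d h =>
    dif_neg (by rw [kj] at h; simpa using h)
  have hF : ∀ d d', R d d' → F d = F d' := by
    rintro d d' (rfl | rfl)
    · by_cases h : k d = true
      · rw [hFt d h, hFf (g d) (by rw [kj, kg, h]; rfl)]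
        exact (hstep ⟨d, h⟩).symm
      · have h' : k (g d) = true := by rw [kg]; simpa using h
        rw [hFf d (by rw [kj]; simpa using h), hFt (g d) h', ← hstep ⟨g d, h'⟩]
        congr 2
        simp [hg]
    · by_cases h : k d = true
      · rw [hFt d h, hFf (j d) (by rw [hj, h])]
        simp only [hj]
      · have h' : k (j d) = true := by rw [kj]; simpa using h
        rw [hFf d h', hFt (j d) h']
  have hmk : ∀ d, Quot.mk R (j d) = Quot.mk R d := fun d =>
    (Quot.sound (r := R) (Or.inr rfl)).symm
  have hmkg : ∀ d, Quot.mk R (g d) = Quot.mk R d := fun d =>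
    (Quot.sound (r := R) (Or.inl rfl)).symm
  have hpow : ∀ (n : ℕ) (e : {d // k d = true}),
      Quot.mk R ((σ ^ n) e : {d // k d = true}).1 = Quot.mk R e.1 := by
    intro n
    induction n with
    | zero => intro e; rfl
    | succ n ih =>
      intro e
      rw [pow_succ, Equiv.Perm.mul_apply, ih]
      exact (hmk _).trans (hmkg _)
  refine Nat.card_congr (α := Quot R) ⟨Quot.lift F hF, Quotient.lift (fun e => Quot.mk R e.1) ?_, ?_, ?_⟩
  · rintro x y ⟨n, hn⟩
    obtain ⟨n, rfl | rfl⟩ := n.eq_nat_or_neg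
    · rw [← hn, zpow_natCast]
      exact (hpow _ _).symm
    · have : x = (σ ^ n) y := by
        rw [← hn, zpow_neg, zpow_natCast]; simp
      rw [this]
      exact hpow _ _
  · rintro ⟨d⟩
    by_cases h : k d = true
    · change Quotient.lift _ _ (F d) = _
      rw [hFt d h]
      rfl
    · change Quotient.lift _ _ (F d) = _
      rw [hFf d (by rw [kj]; simpa using h)]
      exact hmk d
  · rintro ⟨e⟩
    exact hFt e.1 e.2

/-- On the points of colour `true`, `τ * σ⁻¹` is `j' ∘ j`. As `j` and `j'` commute it is an
involution; it moves exactly the points where they differ, so it is a product of `m` transpositions.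
Comparing signs gives the parity, the number of points entering twice. -/
theorem even_card_quot_add_card_quot [Fintype α] {j' : α → α}
    (hg : ∀ d, g (g d) = d) (hj : ∀ d, j (j d) = d) (hj' : ∀ d, j' (j' d) = d)
    (kg : ∀ d, k (g d) = !k d) (kj : ∀ d, k (j d) = !k d) (kj' : ∀ d, k (j' d) = !k d)
    (hcomm : ∀ d, j (j' d) = j' (j d)) (m : ℕ)
    (hm : Nat.card {d // k d = true ∧ j d ≠ j' d} = 2 * m) :
    Even (Nat.card (Quot fun d d' : α => d' = g d ∨ d' = j d) +
      Nat.card (Quot fun d d' : α => d' = g d ∨ d' = j' d) + m) := by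
  classical
  rw [card_quot_matching hg hj kg kj, card_quot_matching hg hj' kg kj']
  set σ := matchingPerm k g j hg hj kg kj with hσ
  set τ := matchingPerm k g j' hg hj' kg kj' with hτ
  have hρ : ∀ e, ((τ * σ⁻¹) e).1 = j' (j e.1) := by
    intro e
    simp [hσ, hτ, matchingPerm, Equiv.Perm.inv_def, Equiv.symm, hg]
  have hsq : (τ * σ⁻¹) ^ 2 = 1 := by
    ext e
    rw [pow_two, Equiv.Perm.mul_apply, hρ, hρ, hcomm, hj', hj]
    rfl
  have hsupp : (τ * σ⁻¹).support.card = 2 * m := by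
    rw [← hm, ← Fintype.card_coe, ← Nat.card_eq_fintype_card]
    refine Nat.card_congr ((Equiv.subtypeEquivRight fun e => ?_).trans
      (Equiv.subtypeSubtypeEquivSubtypeInter (fun d => k d = true) (fun d => j d ≠ j' d)))
    rw [Equiv.Perm.mem_support, Ne, Subtype.ext_iff, hρ, not_iff_not]
    exact ⟨fun h => by rw [← hj' (j e.1), h], fun h => by rw [h, hj']⟩
  have hsign := Equiv.Perm.sign_of_pow_two_eq_one hsq
  have hle := Finset.card_le_univ (τ * σ⁻¹).support
  rw [Equiv.Perm.card_fixedPoints, Equiv.Perm.sum_cycleType, Nat.sub_sub_self hle, hsupp,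
    Nat.mul_div_cancel_left _ two_pos, Equiv.Perm.sign_mul, Equiv.Perm.sign_inv,
    sign_eq_neg_one_pow_card_quotient, sign_eq_neg_one_pow_card_quotient, ← pow_add] at hsign
  -- Multiplying by `(-1) ^ m` makes the right-hand side `1`, so that the total exponent on the left
  -- is even.
  have hone := congrArg (fun u : ℤˣ => ((u * (-1) ^ m : ℤˣ) : ℤ)) hsign
  simp only [← pow_add, Units.val_pow_eq_pow_val, Units.val_neg, Units.val_one] at hone
  rw [Even.neg_one_pow (n := m + m) ⟨m, rfl⟩] at hone
  have heven := (neg_one_pow_eq_one_iff_even (by decide)).1 hone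
  rw [Nat.even_iff] at heven ⊢
  omega

end Matching
-- Planarity and the checkerboard colouring
instance {n : ℕ} (glue : Dart n → Dart n) : Finite (Face glue) :=
  Finite.of_surjective (Quot.mk _) Quot.mk_surjective

instance {n : ℕ} (glue : Dart n → Dart n) : Finite (GraphComponent glue) :=
  Finite.of_surjective (Quot.mk _) Quot.mk_surjective

namespace OrientedLinkDiagram

variable (D : OrientedLinkDiagram)

/-- The edges that meet a crossing, each represented by the end at which it leaves a crossing. -/
abbrev Edge : Type := {d : Dart D.n // outgoing D.positive d = true}

theorem card_edge : Fintype.card D.Edge = 2 * D.n := by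
  rw [Fintype.card_subtype, Finset.card_filter, Fintype.sum_prod_type]
  have : ∀ c : Fin D.n, (∑ i : Fin 4, if outgoing D.positive (c, i) = true then 1 else 0) = 2 := by
    intro c
    cases h : D.positive c <;> simp only [outgoing, h] <;> rfl
  simp [this, mul_comm]

/-- The two ends of the edges are all the ends. -/
theorem sum_edge {K : Type*} [AddCommMonoid K] (G : Dart D.n → K) :
    ∑ e : D.Edge, (G e + G (D.glue e)) = ∑ d, G d := by
  rw [← Fintype.sum_subtype_add_sum_subtype (fun d => outgoing D.positive d = true) G,
    Finset.sum_add_distrib]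
  congr 1
  refine Fintype.sum_equiv (⟨fun e => ⟨D.glue e, ?_⟩, fun e => ⟨D.glue e, ?_⟩, ?_, ?_⟩ :
    D.Edge ≃ {d : Dart D.n // ¬ outgoing D.positive d = true}) _ _ ?_
  · rw [D.outgoing_glue, e.2]; simp
  · rw [D.outgoing_glue]; simpa using e.2
  · intro e; simp [D.glue_glue]
  · intro e; simp [D.glue_glue]
  · intro e; rfl

theorem forall_edge_iff {P : Dart D.n → Prop} (hP : ∀ d, P d → P (D.glue d)) :
    (∀ e : D.Edge, P e) ↔ ∀ d, P d := by
  refine ⟨fun h d => ?_, fun h e => h e⟩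
  by_cases hd : outgoing D.positive d = true
  · exact h ⟨d, hd⟩
  · have := hP _ (h ⟨D.glue d, by rw [D.outgoing_glue]; simpa using hd⟩)
    rwa [D.glue_glue] at this

/-- The incidence matrix modulo `2` of edges and crossings. -/
def incidence : Matrix D.Edge (Fin D.n) (ZMod 2) := fun e v =>
  (if e.1.1 = v then 1 else 0) + (if (D.glue e).1 = v then 1 else 0)

theorem incidence_mulVec (h : Fin D.n → ZMod 2) (e : D.Edge) :
    (D.incidence.mulVec h) e = h e.1.1 + h (D.glue e).1 := by
  simp [Matrix.mulVec, dotProduct, incidence, add_mul, Finset.sum_add_distrib]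

theorem incidence_transpose_mulVec (γ : Dart D.n → ZMod 2) (hγ : ∀ d, γ (D.glue d) = γ d)
    (v : Fin D.n) :
    (D.incidence.transpose.mulVec fun e => γ e) v = ∑ i : Fin 4, γ (v, i) := by
  have h1 : (D.incidence.transpose.mulVec fun e => γ e) v =
      ∑ e : D.Edge, ((if e.1.1 = v then γ e else 0) +
        (if (D.glue e).1 = v then γ (D.glue e) else 0)) := by
    simp [Matrix.mulVec, dotProduct, incidence, add_mul, hγ]
  rw [h1, D.sum_edge (fun d => if d.1 = v then γ d else 0), Fintype.sum_prod_type,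
    Finset.sum_eq_single v]
  · simp
  · intro w _ hw; simp [hw]
  · simp

/-- The face along the edge that starts at the end `d`. -/
def faceAt (d : Dart D.n) : Face D.glue := Quot.mk _ d

/-- The component of the graph that contains the end `d`. -/
def componentAt (d : Dart D.n) : GraphComponent D.glue := Quot.mk _ d

/-- The value on an edge is the sum of the values on the two faces along it. -/
def faceBoundary : (Face D.glue → ZMod 2) →ₗ[ZMod 2] (D.Edge → ZMod 2) where
  toFun f e := f (D.faceAt e.1) + f (D.faceAt (D.glue e))
  map_add' f g := by ext e; exact add_add_add_comm _ _ _ _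
  map_smul' a f := by ext e; exact (mul_add _ _ _).symm

variable {D}

theorem faceAt_rot (d : Dart D.n) : D.faceAt (rot d) = D.faceAt (D.glue d) := by
  have : D.faceAt (D.glue d) = D.faceAt (rot (D.glue (D.glue d))) := Quot.sound rfl
  rw [this, D.glue_glue]

theorem componentAt_rot (d : Dart D.n) : D.componentAt (rot d) = D.componentAt d :=
  (Quot.sound (r := fun d d' => d' = rot d ∨ d' = D.glue d) (Or.inl rfl)).symm

theorem componentAt_glue (d : Dart D.n) : D.componentAt (D.glue d) = D.componentAt d :=
  (Quot.sound (r := fun d d' => d' = rot d ∨ d' = D.glue d) (Or.inr rfl)).symm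

theorem componentAt_crossing (v : Fin D.n) (i : Fin 4) :
    D.componentAt (v, i) = D.componentAt (v, 0) := by
  have h1 : D.componentAt (v, 1) = D.componentAt (v, 0) := componentAt_rot (v, 0)
  have h2 : D.componentAt (v, 2) = D.componentAt (v, 1) := componentAt_rot (v, 1)
  have h3 : D.componentAt (v, 3) = D.componentAt (v, 2) := componentAt_rot (v, 2)
  fin_cases i
  · rfl
  · exact h1
  · exact h2.trans h1
  · exact h3.trans (h2.trans h1)

theorem add_eq_zero_iff_eq_zmod_two {a b : ZMod 2} : a + b = 0 ↔ a = b := by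
  rw [← CharTwo.sub_eq_add, sub_eq_zero]

/-- Modulo 2, a vanishing sum over the ends of an edge means equal values, so the kernel consists of
the functions constant on components. -/
theorem finrank_ker_incidence :
    Module.finrank (ZMod 2) (LinearMap.ker D.incidence.mulVecLin) =
      Nat.card (GraphComponent D.glue) := by
  have := Fintype.ofFinite (GraphComponent D.glue)
  let q : Fin D.n → GraphComponent D.glue := fun v => D.componentAt (v, 0)
  have hq : Function.Surjective q := by
    rintro ⟨v, i⟩
    exact ⟨v, (componentAt_crossing v i).symm⟩
  have hker : LinearMap.ker D.incidence.mulVecLin =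
      LinearMap.range (LinearMap.funLeft (ZMod 2) (ZMod 2) q) := by
    ext h
    have hmem : h ∈ LinearMap.ker D.incidence.mulVecLin ↔ ∀ d : Dart D.n, h d.1 = h (D.glue d).1 := by
      rw [← D.forall_edge_iff (P := fun d => h d.1 = h (D.glue d).1)
        (fun d hd => by rw [D.glue_glue, hd]), LinearMap.mem_ker, Matrix.mulVecLin_apply, funext_iff]
      simp only [incidence_mulVec, Pi.zero_apply, add_eq_zero_iff_eq_zmod_two]
    rw [hmem, LinearMap.mem_range]
    constructor
    · intro hh
      refine ⟨Quot.lift (fun d => h d.1) ?_, rfl⟩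
      rintro d d' (rfl | rfl)
      · rfl
      · exact hh d
    · rintro ⟨f, rfl⟩ d
      simp only [LinearMap.funLeft_apply, q]
      rw [← componentAt_crossing d.1 d.2, ← componentAt_crossing (D.glue d).1 (D.glue d).2]
      exact congrArg f (componentAt_glue d).symm
  rw [hker, LinearMap.finrank_range_of_inj (LinearMap.funLeft_injective_of_surjective _ _ _ hq),
    Module.finrank_fintype_fun_eq_card, Nat.card_eq_fintype_card]

/-- Here too the kernel is the functions constant on components: `rot d` lies on the face across the
edge at `d`, so turning at a crossing also keeps the value. -/
theorem finrank_ker_faceBoundary :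
    Module.finrank (ZMod 2) (LinearMap.ker D.faceBoundary) =
      Nat.card (GraphComponent D.glue) := by
  have := Fintype.ofFinite (GraphComponent D.glue)
  let q : Face D.glue → GraphComponent D.glue :=
    Quot.lift D.componentAt fun d d' h => by rw [h, componentAt_rot, componentAt_glue]
  have hq : Function.Surjective q := by
    rintro ⟨d⟩
    exact ⟨D.faceAt d, rfl⟩
  have hker : LinearMap.ker D.faceBoundary =
      LinearMap.range (LinearMap.funLeft (ZMod 2) (ZMod 2) q) := by
    ext h
    have hmem : h ∈ LinearMap.ker D.faceBoundary ↔
        ∀ d : Dart D.n, h (D.faceAt d) = h (D.faceAt (D.glue d)) := by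
      rw [← D.forall_edge_iff (P := fun d => h (D.faceAt d) = h (D.faceAt (D.glue d)))
        (fun d hd => by rw [D.glue_glue, hd]), LinearMap.mem_ker, funext_iff]
      simp only [faceBoundary, LinearMap.coe_mk, AddHom.coe_mk, Pi.zero_apply,
        add_eq_zero_iff_eq_zmod_two]
    rw [hmem, LinearMap.mem_range]
    constructor
    · intro hh
      refine ⟨Quot.lift (fun d => h (D.faceAt d)) ?_, ?_⟩
      · rintro d d' (rfl | rfl)
        · rw [faceAt_rot, ← hh]
        · exact hh d
      · ext ⟨d⟩
        rfl
    · rintro ⟨f, rfl⟩ d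
      exact congrArg f (componentAt_glue d).symm
  rw [hker, LinearMap.finrank_range_of_inj (LinearMap.funLeft_injective_of_surjective _ _ _ hq),
    Module.finrank_fintype_fun_eq_card, Nat.card_eq_fintype_card]

/-- Every mod 2 cycle bounds. Around a crossing each of the four corners is counted twice, which
gives one inclusion. The dimensions are `F - C` and `E - (V - C)`, equal by Euler's formula. -/
theorem range_faceBoundary :
    LinearMap.range D.faceBoundary = LinearMap.ker D.incidence.transpose.mulVecLin := by
  have := Fintype.ofFinite (Face D.glue)
  apply Submodule.eq_of_le_of_finrank_eq
  · rintro _ ⟨f, rfl⟩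
    rw [LinearMap.mem_ker, Matrix.mulVecLin_apply]
    ext v
    have h := D.incidence_transpose_mulVec
      (fun d => f (D.faceAt d) + f (D.faceAt (D.glue d)))
      (fun d => by rw [D.glue_glue, add_comm]) v
    refine h.trans ?_
    simp only [← faceAt_rot]
    rw [Fin.sum_univ_four]
    change f (D.faceAt (v, 0)) + f (D.faceAt (v, 1)) + (f (D.faceAt (v, 1)) + f (D.faceAt (v, 2))) +
      (f (D.faceAt (v, 2)) + f (D.faceAt (v, 3))) + (f (D.faceAt (v, 3)) + f (D.faceAt (v, 0))) = 0
    generalize f (D.faceAt (v, 0)) = a, f (D.faceAt (v, 1)) = b, f (D.faceAt (v, 2)) = c,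
      f (D.faceAt (v, 3)) = d
    revert a b c d
    decide
  · have h1 := LinearMap.finrank_range_add_finrank_ker D.faceBoundary
    have h2 := LinearMap.finrank_range_add_finrank_ker D.incidence.mulVecLin
    have h3 := LinearMap.finrank_range_add_finrank_ker D.incidence.transpose.mulVecLin
    have h4 := D.incidence.rank_transpose
    rw [Matrix.rank, Matrix.rank] at h4
    rw [finrank_ker_faceBoundary, Module.finrank_fintype_fun_eq_card,
      ← Nat.card_eq_fintype_card] at h1
    rw [finrank_ker_incidence, Module.finrank_fintype_fun_eq_card, Fintype.card_fin] at h2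
    rw [Module.finrank_fintype_fun_eq_card, card_edge] at h3
    have h5 := D.planar
    omega

/-- The faces of a planar diagram have a checkerboard colouring. -/
theorem exists_checkerboard : ∃ κ : Dart D.n → Bool,
    (∀ d, κ (D.glue d) = !κ d) ∧ ∀ d, κ (rot d) = !κ d := by
  -- Every crossing has four ends, so the sum of all edges is a cycle modulo 2; the faces that it
  -- bounds are those of one colour.
  have hone : (fun _ => 1 : D.Edge → ZMod 2) ∈ LinearMap.range D.faceBoundary := by
    rw [range_faceBoundary, LinearMap.mem_ker, Matrix.mulVecLin_apply]
    ext v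
    rw [D.incidence_transpose_mulVec (fun _ => 1) (fun _ => rfl) v]
    rfl
  obtain ⟨f, hf⟩ := hone
  have hf' : ∀ d : Dart D.n, f (D.faceAt d) + f (D.faceAt (D.glue d)) = 1 := by
    rw [← D.forall_edge_iff (fun d hd => by rw [D.glue_glue, add_comm, hd])]
    exact fun e => congrFun hf e
  have key : ∀ a b : ZMod 2, a + b = 1 → decide (b = 1) = !decide (a = 1) := by decide
  refine ⟨fun d => decide (f (D.faceAt d) = 1), fun d => key _ _ (hf' d), fun d => ?_⟩
  simp only [faceAt_rot]
  exact key _ _ (hf' d)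

end OrientedLinkDiagram
-- Parities of numbers of circles and components
theorem card_dart_subtype {n : ℕ} (Q : Dart n → Prop) [DecidablePred Q] (P : Fin n → Prop)
    [DecidablePred P]
    (h : ∀ c, (Finset.univ.filter fun i => Q (c, i)).card = if P c then 2 else 0) :
    Nat.card {d // Q d} = 2 * (Finset.univ.filter P).card := by
  rw [Nat.card_eq_fintype_card, Fintype.card_subtype, Finset.card_filter, Fintype.sum_prod_type,
    Finset.card_filter, Finset.mul_sum]
  refine Finset.sum_congr rfl fun c _ => ?_
  rw [← Finset.card_filter, h]
  split_ifs <;> rfl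

theorem Marker.join_join (m : Marker) (i : Fin 4) : m.join (m.join i) = i := by
  revert i; cases m <;> decide

theorem Marker.join_comm (m m' : Marker) (i : Fin 4) :
    m.join (m'.join i) = m'.join (m.join i) := by
  revert i; cases m <;> cases m' <;> decide

theorem Marker.join_add_two (m : Marker) (i : Fin 4) : m.join (i + 2) = m.join i + 2 := by
  revert i; cases m <;> decide

namespace OrientedLinkDiagram

variable {D : OrientedLinkDiagram}

theorem State.numCircles_eq (s : D.State) : s.numCircles =
    Nat.card (Quot fun d d' : Dart D.n => d' = D.glue d ∨ d' = (d.1, (s d.1).join d.2)) +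
      D.loops := by
  rw [State.numCircles, State.Circle, Nat.card_sum, Nat.card_fin]

theorem numComponents_eq : D.numComponents =
    Nat.card (Quot fun d d' : Dart D.n => d' = D.glue d ∨ d' = opp d) + D.loops := by
  rw [numComponents, LinkComponent, Nat.card_sum, Nat.card_fin]

/-- Changing one marker changes the number of circles by one, modulo `2`. -/
theorem State.even_numCircles_add (s : D.State) :
    Even (D.stateA.numCircles + s.numCircles + s.b) := by
  obtain ⟨κ, hglue, hrot⟩ := D.exists_checkerboard
  have h1 : ∀ c, κ (c, 1) = !κ (c, 0) := fun c => hrot (c, 0)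
  have h2 : ∀ c, κ (c, 2) = κ (c, 0) := fun c => by
    rw [show κ (c, 2) = !κ (c, 1) from hrot (c, 1), h1, Bool.not_not]
  have h3 : ∀ c, κ (c, 3) = !κ (c, 0) := fun c => by
    rw [show κ (c, 3) = !κ (c, 2) from hrot (c, 2), h2]
  -- Both smoothings join neighbouring ends, and these have opposite colours.
  have hjoin : ∀ (m : Marker) (c : Fin D.n) (i : Fin 4), κ (c, m.join i) = !κ (c, i) := by
    intro m c i
    cases m <;> fin_cases i <;> simp [Marker.join, h1, h2, h3]
  have key := even_card_quot_add_card_quot (k := κ) (g := D.glue)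
    (j := fun d => (d.1, (D.stateA d.1).join d.2)) (j' := fun d => (d.1, (s d.1).join d.2))
    D.glue_glue (fun d => by simp [Marker.join_join]) (fun d => by simp [Marker.join_join])
    hglue (fun d => hjoin _ _ _) (fun d => hjoin _ _ _) (fun d => by simp [Marker.join_comm])
    -- At a crossing that `s` marks `B`, both ends of colour `true` change partner; elsewhere none
    -- does.
    s.b (by
      refine card_dart_subtype _ _ fun c => ?_
      rw [Finset.card_filter, Fin.sum_univ_four]
      cases hk : κ (c, 0) <;> cases s c <;> simp [stateA, Marker.join, h1, h2, h3, hk])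
  rw [D.stateA.numCircles_eq, s.numCircles_eq]
  rw [Nat.even_iff] at key ⊢
  omega

/-- The oriented smoothing. -/
def orientedState (D : OrientedLinkDiagram) : D.State :=
  fun c => if D.positive c = true then Marker.A else Marker.B

theorem orientedState_b : D.orientedState.b = D.nNeg := by
  rw [State.b, nNeg]
  congr 1
  ext c
  cases h : D.positive c <;> simp [orientedState, h]

theorem nPos_add_nNeg : D.nPos + D.nNeg = D.n := by
  have := Finset.card_filter_add_card_filter_not (s := (Finset.univ : Finset (Fin D.n)))
    (fun c => D.positive c = true)
  simpa [nPos, nNeg] using this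

/-- The numbers of components of the link and of Seifert circles. -/
theorem even_numCircles_orientedState_add :
    Even (D.orientedState.numCircles + D.numComponents + D.n) := by
  -- The colour is now the orientation: the oriented smoothing and going straight on both join an
  -- incoming to an outgoing end, and they differ at both outgoing ends of every crossing, so `m =
  -- n`.
  have key := even_card_quot_add_card_quot (k := outgoing D.positive) (g := D.glue)
    (j := fun d => (d.1, (D.orientedState d.1).join d.2)) (j' := opp)
    D.glue_glue (fun d => by simp [Marker.join_join])
    (fun d => by simp [opp, add_assoc, show (2 : Fin 4) + 2 = 0 from rfl])
    D.outgoing_glue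
    (fun ⟨c, i⟩ => by
      cases h : D.positive c <;> fin_cases i <;> simp [outgoing, orientedState, Marker.join, h])
    (fun ⟨c, i⟩ => by
      cases h : D.positive c <;> fin_cases i <;> simp [outgoing, opp, h])
    (fun d => by simp [opp, Marker.join_add_two])
    D.n (by
      rw [card_dart_subtype _ (fun _ => True) fun c => ?_]
      · simp
      · rw [Finset.card_filter, Fin.sum_univ_four]
        cases h : D.positive c <;> simp [orientedState, Marker.join, opp, outgoing, h])
  rw [State.numCircles_eq, numComponents_eq]
  rw [Nat.even_iff] at key ⊢
  omega

/-- The oriented smoothing has `b = n_-` and links the two preceding parities; its number of circles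
cancels, leaving `n - n_- = n_+`. -/
theorem even_nPos_add_numCircles_add_numComponents :
    Even (D.nPos + D.stateA.numCircles + D.numComponents) := by
  have h1 := D.orientedState.even_numCircles_add
  have h2 := D.even_numCircles_orientedState_add
  have h3 := D.nPos_add_nNeg
  rw [orientedState_b] at h1
  rw [Nat.even_iff] at h1 h2 ⊢
  omega

theorem Gen.even_deg_V_sub (x : D.Gen) : Even (x.deg V - x.state.numCircles) := by
  have : x.deg V - x.state.numCircles = ∑ γ, (V.deg (x.label γ) - 1) := by
    rw [Finset.sum_sub_distrib, Gen.deg]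
    simp [State.numCircles, Nat.card_eq_fintype_card]
  rw [this]
  refine Finset.even_sum _ fun γ _ => ?_
  cases x.label γ <;> decide

/-- Khovanov homology lives in degrees of the parity of the number of components. -/
theorem Gen.even_add_numComponents (x : D.Gen) {l : ℤ}
    (h : x.deg V + x.state.b = l - D.nPos + 2 * D.nNeg) : Even (l + D.numComponents) := by
  have h1 := x.even_deg_V_sub
  have h2 := x.state.even_numCircles_add
  have h3 := D.even_nPos_add_numCircles_add_numComponents
  rw [Int.even_iff] at *
  rw [Nat.even_iff] at h2 h3
  omega

end OrientedLinkDiagram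
-- Exchange of generators and comparison of the complexes
/-- The exchange of the two generators. -/
def Sgn.flip : Sgn → Sgn
  | .plus => .minus
  | .minus => .plus

theorem Sgn.flip_flip (x : Sgn) : x.flip.flip = x := by cases x <;> rfl

theorem Sgn.flip_inj {x y : Sgn} : x.flip = y.flip ↔ x = y :=
  (Function.LeftInverse.injective Sgn.flip_flip).eq_iff

theorem V_mul_flip (x y z : Sgn) : V.mul x.flip y.flip z.flip = W.mul x y z := by
  cases x <;> cases y <;> cases z <;> rfl

theorem V_comul_flip (x y z : Sgn) : V.comul x.flip y.flip z.flip = W.comul x y z := by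
  cases x <;> cases y <;> cases z <;> rfl

theorem W_deg_eq (x : Sgn) : W.deg x = -2 * V.deg x.flip := by
  cases x <;> rfl

namespace OrientedLinkDiagram

variable {D : OrientedLinkDiagram}

/-- The exchange of the two generators in all tensor factors. -/
def Gen.flip (x : D.Gen) : D.Gen := ⟨x.state, fun γ => (x.label γ).flip⟩

theorem Gen.flip_flip (x : D.Gen) : x.flip.flip = x := by
  cases x
  simp [Gen.flip, Sgn.flip_flip]

/-- The exchange of generators as a permutation of the basis. -/
def Gen.flipEquiv (D : OrientedLinkDiagram) : D.Gen ≃ D.Gen :=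
  ⟨Gen.flip, Gen.flip, Gen.flip_flip, Gen.flip_flip⟩

/-- The exchange of generators as an automorphism of the cube. -/
noncomputable def flipCube (D : OrientedLinkDiagram) : D.Cube ≃ₗ[ℤ] D.Cube :=
  Finsupp.domLCongr (Gen.flipEquiv D)

theorem flipCube_apply (z : D.Cube) (y : D.Gen) : D.flipCube z y = z y.flip := rfl

theorem flipCube_single (x : D.Gen) (a : ℤ) :
    D.flipCube (Finsupp.single x a) = Finsupp.single x.flip a :=
  Finsupp.domLCongr_single _ _ _

theorem Gen.deg_W_eq (x : D.Gen) : x.deg W = -2 * x.flip.deg V := by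
  rw [Gen.deg, Gen.deg, Finset.mul_sum]
  exact Finset.sum_congr rfl fun γ _ => W_deg_eq _

/-- Whether an edge merges or splits depends only on the states, which the exchange keeps. -/
theorem edgeCoeff_flip (c : Fin D.n) (x y : D.Gen) :
    edgeCoeff V c x.flip y.flip = edgeCoeff W c x y := by
  classical
  apply if_congr
  · refine and_congr (forall_congr' fun d => imp_congr_right fun _ => imp_congr_right fun _ => ?_)
      (forall_congr' fun l => Sgn.flip_inj)
    exact Sgn.flip_inj
  · apply if_congr Iff.rfl
    · exact V_mul_flip _ _ _
    · apply if_congr Iff.rfl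
      · exact V_comul_flip _ _ _
      · rfl
  · rfl

open Classical in
theorem diff_single_apply (F : TwoGen) (x y : D.Gen) :
    D.diff F (Finsupp.single x 1) y = ∑ c : Fin D.n,
      if x.state c = Marker.A ∧ y.state = Function.update x.state c Marker.B then
        (-1) ^ (Finset.univ.filter fun c' => c' < c ∧ x.state c' = Marker.B).card *
          edgeCoeff F c x y
      else 0 := by
  rw [diff, Finsupp.linearCombination_single, one_smul, Finsupp.finsetSum_apply,
    Finset.sum_eq_single y]
  · rw [Finsupp.finsetSum_apply]
    refine Finset.sum_congr rfl fun c _ => ?_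
    split_ifs
    · exact Finsupp.single_eq_same
    · rfl
  · intro y' _ hy'
    rw [Finsupp.finsetSum_apply]
    refine Finset.sum_eq_zero fun c _ => ?_
    split_ifs
    · exact Finsupp.single_eq_of_ne (Ne.symm hy')
    · rfl
  · intro h
    exact absurd (Finset.mem_univ y) h

theorem diff_flipCube (z : D.Cube) :
    D.diff V (D.flipCube z) = D.flipCube (D.diff W z) := by
  have : D.diff V ∘ₗ D.flipCube.toLinearMap = D.flipCube.toLinearMap ∘ₗ D.diff W := by
    refine Finsupp.lhom_ext' fun x => LinearMap.ext_ring ?_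
    simp only [LinearMap.comp_apply, Finsupp.lsingle_apply, LinearEquiv.coe_coe, flipCube_single]
    ext y
    rw [flipCube_apply, diff_single_apply, diff_single_apply]
    refine Finset.sum_congr rfl fun c _ => ?_
    rw [← edgeCoeff_flip, Gen.flip_flip]
    rfl
  exact LinearMap.congr_fun this z

theorem Gen.b_eq_of_diff_ne_zero {F : TwoGen} {x y : D.Gen}
    (h : D.diff F (Finsupp.single x 1) y ≠ 0) : y.state.b = x.state.b + 1 := by
  classical
  rw [diff_single_apply] at h
  obtain ⟨c, -, hc⟩ := Finset.exists_ne_zero_of_sum_ne_zero h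
  rw [ne_eq, ite_eq_right_iff, not_forall] at hc
  obtain ⟨⟨hA, hy⟩, -⟩ := hc
  rw [State.b, State.b, hy]
  have : (Finset.univ.filter fun c' => Function.update x.state c Marker.B c' = Marker.B) =
      insert c (Finset.univ.filter fun c' => x.state c' = Marker.B) := by
    ext c'
    by_cases h : c' = c
    · subst h; simp
    · simp [h]
  rw [this, Finset.card_insert_of_notMem (by simp [hA])]

theorem State.a_add_b (s : D.State) : s.a + s.b = D.n := by
  have := Finset.card_filter_add_card_filter_not (s := (Finset.univ : Finset (Fin D.n)))
    (fun c => s c = Marker.A)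
  rw [Finset.card_univ, Fintype.card_fin] at this
  rw [State.a, State.b]
  refine Eq.trans ?_ this
  congr 2
  ext c
  rw [Finset.mem_filter_univ, Finset.mem_filter_univ]
  cases s c <;> decide

theorem mem_bracket_iff (i : ZMod 2) {j : ℤ} (hj : Even j) (z : D.Cube) :
    z ∈ D.bracket (i + (D.writhe : ZMod 2)) (j + 3 * D.writhe) ↔
      D.flipCube z ∈ Finsupp.supported ℤ ℤ
        {x : D.Gen | (((x.state.b - D.nNeg : ℤ)) : ZMod 2) =
            i + ((D.nPos + D.stateA.numCircles : ℕ) : ZMod 2) ∧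
          x ∈ {x : D.Gen | x.deg V + x.state.b = -(j / 2) - D.nPos + 2 * D.nNeg}} := by
  have key : ∀ x : D.Gen,
      (((x.state.b + D.stateA.numCircles : ℕ) : ZMod 2) = i + (D.writhe : ZMod 2) ∧
        x.deg W + ((x.state.a : ℤ) - x.state.b) = j + 3 * D.writhe) ↔
      ((((x.flip.state.b - D.nNeg : ℤ)) : ZMod 2) =
          i + ((D.nPos + D.stateA.numCircles : ℕ) : ZMod 2) ∧
        x.flip.deg V + x.flip.state.b = -(j / 2) - D.nPos + 2 * D.nNeg) := by
    intro x
    change _ ↔ ((((x.state.b - D.nNeg : ℤ)) : ZMod 2) = _ ∧ _ + (x.state.b : ℤ) = _)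
    refine and_congr ?_ ?_
    · rw [writhe]
      push_cast
      generalize (x.state.b : ZMod 2) = b, (D.stateA.numCircles : ZMod 2) = s,
        (D.nPos : ZMod 2) = p, (D.nNeg : ZMod 2) = n
      revert i b s p n
      decide
    -- By `a + b = n_+ + n_-`, the second equation is the first divided by `-2`; as `j` is even, `j
    -- / 2` is exact.
    · have h1 := x.state.a_add_b
      have h2 := D.nPos_add_nNeg
      rw [Gen.deg_W_eq, writhe]
      obtain ⟨t, rfl⟩ := hj
      omega
  rw [bracket, Finsupp.mem_supported', Finsupp.mem_supported',
    ← (Gen.flipEquiv D).forall_congr_right]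
  refine forall_congr' fun x => ?_
  have hx := key x.flip
  rw [Gen.flip_flip] at hx
  exact imp_congr_left (not_congr hx)

theorem nonempty_ddotH_equiv (i : ZMod 2) {j : ℤ} (hj : Even j) :
    Nonempty (D.ddotH i j ≃+
      ⨁ k : {k : ℤ // (k : ZMod 2) = i + ((D.nPos + D.stateA.numCircles : ℕ) : ZMod 2)},
        D.Kh k (-(j / 2))) := by
  have hz : ∀ r i c : ZMod 2, r - 1 = i + 1 + c ↔ r = i + c := by decide
  obtain ⟨e⟩ := nonempty_subquotient_equiv (d := D.diff W) (d' := D.diff V)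
    D.flipCube diff_flipCube (mem_bracket_iff i hj)
    (mem_bracket_iff (i + 1) hj)
  obtain ⟨f⟩ := nonempty_subquotient_equiv_directSum (d := D.diff V)
    (b := fun x : D.Gen => (x.state.b : ℤ) - D.nNeg)
    (T := {x : D.Gen | x.deg V + x.state.b = -(j / 2) - D.nPos + 2 * D.nNeg})
    (fun x y h => by
      have := Gen.b_eq_of_diff_ne_zero h
      omega)
    (fun k => (k : ZMod 2) = i + 1 + ((D.nPos + D.stateA.numCircles : ℕ) : ZMod 2))
    (fun k => (k : ZMod 2) = i + ((D.nPos + D.stateA.numCircles : ℕ) : ZMod 2))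
    (fun r => by
      push_cast
      exact hz _ _ _)
    (fun k => D.khBracket (k - 1 + D.nNeg) (-(j / 2) - D.nPos + 2 * D.nNeg))
    (fun k => D.khBracket (k + D.nNeg) (-(j / 2) - D.nPos + 2 * D.nNeg))
    (fun k => by
      rw [khBracket]
      congr 1
      ext x
      exact and_congr_left fun _ => by omega)
    (fun k => by
      rw [khBracket]
      congr 1
      ext x
      exact and_congr_left fun _ => by omega)
  -- The boundaries of `ddotH` sit in index `i + w + 1`, those of `e` in `i + 1 + w`.
  rw [add_right_comm] at e
  exact ⟨e.trans f⟩

theorem subsingleton_Kh {l : ℤ} (h : Odd (l + D.numComponents)) (k : ℤ) :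
    Subsingleton (D.Kh k l) := by
  refine subsingleton_subquotient ?_
  rw [khBracket, ← Finsupp.supported_empty]
  congr 1
  ext x
  simp only [Set.mem_ofPred_eq, Set.mem_empty_iff_false, iff_false]
  exact fun hx => (Int.not_even_iff_odd.2 h) (x.even_add_numComponents hx.2)

theorem subsingleton_ddotH (i : ZMod 2) {j : ℤ} (hj : Even j)
    (h : Odd (-(j / 2) + D.numComponents)) : Subsingleton (D.ddotH i j) := by
  obtain ⟨e⟩ := D.nonempty_ddotH_equiv i hj
  have := D.subsingleton_Kh h
  have : Subsingleton (⨁ k : {k : ℤ //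
      (k : ZMod 2) = i + ((D.nPos + D.stateA.numCircles : ℕ) : ZMod 2)},
        D.Kh k (-(j / 2))) := ⟨fun u v => DFinsupp.ext fun k => Subsingleton.elim _ _⟩
  exact e.toEquiv.subsingleton

end OrientedLinkDiagram
end KauffmanCat

/-! ### The theorem -/

open KauffmanCat in
theorem mainTheorem6 (D : OrientedLinkDiagram) :
    (∀ (i : ZMod 2) (j : ℤ), Even j →
      ((4 : ℤ) ∣ j →
        Nonempty (D.ddotH i j ≃+
          ⨁ k : {k : ℤ // (k : ZMod 2) = i}, D.Kh k (-(j / 2)))) ∧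
      (¬ (4 : ℤ) ∣ j →
        Nonempty (D.ddotH i j ≃+
          ⨁ k : {k : ℤ // (k : ZMod 2) = i + 1}, D.Kh k (-(j / 2))))) ∧
    (∀ (i : ZMod 2) (j : ℤ), Even j →
      Nonempty (D.ddotH i j ≃+
        ⨁ k : {k : ℤ // (k : ZMod 2) = i + ((D.nPos + D.stateA.numCircles : ℕ) : ZMod 2)},
          D.Kh k (-(j / 2)))) ∧
    (Odd D.numComponents →
      Odd (D.nPos + D.stateA.numCircles) ∧
        ∀ (i : ZMod 2) (j : ℤ), (4 : ℤ) ∣ j → Subsingleton (D.ddotH i j)) ∧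
    (Even D.numComponents →
      Even (D.nPos + D.stateA.numCircles) ∧
        ∀ (i : ZMod 2) (j : ℤ), j % 4 = 2 → Subsingleton (D.ddotH i j)) := by

  have hpar := D.even_nPos_add_numCircles_add_numComponents
  have hsub : ∀ (i : ZMod 2) (j : ℤ), Even j → Odd (j / 2 + D.numComponents) →
      Subsingleton (D.ddotH i j) := by
    intro i j hj h
    refine D.subsingleton_ddotH i hj ?_
    rw [Int.odd_iff] at h ⊢
    omega
  -- For the wrong parity of `j / 2 + N` both sides are zero, whatever set of degrees `k` is summed
  -- over.
  have hvanish : ∀ (i : ZMod 2) (j : ℤ), Even j → Odd (j / 2 + D.numComponents) → ∀ P : ℤ → Prop,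
      Nonempty (D.ddotH i j ≃+ ⨁ k : {k : ℤ // P k}, D.Kh k (-(j / 2))) := by
    intro i j hj h P
    have := hsub i j hj h
    have := D.subsingleton_Kh (l := -(j / 2)) (by rw [Int.odd_iff] at h ⊢; omega)
    have : Subsingleton (⨁ k : {k : ℤ // P k}, D.Kh k (-(j / 2))) :=
      ⟨fun u v => DFinsupp.ext fun k => Subsingleton.elim _ _⟩
    exact ⟨⟨⟨0, 0, fun _ => Subsingleton.elim _ _, fun _ => Subsingleton.elim _ _⟩,
      fun _ _ => Subsingleton.elim _ _⟩⟩
  have hequiv : ∀ (i : ZMod 2) (j : ℤ), Even j → ∀ e : ZMod 2,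
      i + ((D.nPos + D.stateA.numCircles : ℕ) : ZMod 2) = e →
      Nonempty (D.ddotH i j ≃+ ⨁ k : {k : ℤ // (k : ZMod 2) = e}, D.Kh k (-(j / 2))) := by
    rintro i j hj _ rfl
    exact D.nonempty_ddotH_equiv i hj
  refine ⟨fun i j hj => ⟨fun h4 => ?_, fun h4 => ?_⟩, fun i j hj => D.nonempty_ddotH_equiv i hj,
    fun hN => ⟨?_, fun i j h4 => ?_⟩, fun hN => ⟨?_, fun i j h4 => ?_⟩⟩
  · rcases Nat.even_or_odd D.numComponents with hN | hN
    · have hc : ((D.nPos + D.stateA.numCircles : ℕ) : ZMod 2) = 0 := by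
        rw [ZMod.natCast_eq_zero_iff_even]
        exact (Nat.even_add.1 hpar).2 hN
      exact hequiv i j hj _ (by rw [hc, add_zero])
    · refine hvanish i j hj ?_ _
      rw [Nat.odd_iff] at hN
      rw [Int.odd_iff]
      omega
  · rcases Nat.even_or_odd D.numComponents with hN | hN
    · refine hvanish i j hj ?_ _
      rw [Nat.even_iff] at hN
      rw [Int.even_iff] at hj
      rw [Int.odd_iff]
      omega
    · have hc : ((D.nPos + D.stateA.numCircles : ℕ) : ZMod 2) = 1 := by
        rw [ZMod.natCast_eq_one_iff_odd]
        exact (Nat.even_add'.1 hpar).2 hN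
      exact hequiv i j hj _ (by rw [hc])
  · exact (Nat.even_add'.1 hpar).2 hN
  · rw [Nat.odd_iff] at hN
    exact hsub i j (by rw [Int.even_iff]; omega) (by rw [Int.odd_iff]; omega)
  · exact (Nat.even_add.1 hpar).2 hN
  · rw [Nat.even_iff] at hN
    exact hsub i j (by rw [Int.even_iff]; omega) (by rw [Int.odd_iff]; omega)
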